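/- Let $X$ be a random vector in $\mathbb{R}^d$ with $\mathbb{E}X=0$, let $\alpha\in(1,2]$, and let $X_1,\dots,X_n$ ($n\ge 1$) be i.i.d. copies of $X$. For a symmetric matrix $A=V\,\mathrm{diag}(\lambda_1,\dots,\lambda_d)\,V^T$ with $V$ orthogonal, write $|A|^\alpha:=V\,\mathrm{diag}(|\lambda_1|^\alpha,\dots,|\lambda_d|^\alpha)\,V^T$; let $\|\cdot\|_2$ denote the spectral norm of a matrix and the Euclidean norm of a vector. Assume that $\mathbb{E}|XX^T|^\alpha$ is finite (has finite entries, i.e. $\left\|\mathbb{E}|XX^T|^\alpha\right\|_2<\infty$), and put $$\Sigma:=\mathbb{E}[XX^T],\qquad \sigma^\alpha:=\left\|\mathbb{E}|XX^T|^\alpha\right\|_2,\qquad \bar d_\alpha:=\frac{\operatorname{tr}\left(\mathbb{E}|XX^T|^\alpha\right)}{\left\|\mathbb{E}|XX^T|^\alpha\right\|_2},$$ with the convention $\bar d_\alpha:=0$ if $X=0$ almost surely. For $\tau>0$ let $\psi_\tau(x):=\min(|x|,\tau)\operatorname{sign}(x)$ and define the truncated covariance estimator $$\widehat\Sigma_n(\alpha,\tau):=\frac1n\sum_{i=1}^n\psi_\tau\left(\|X_i\|_2^2\right)\frac{X_iX_i^T}{\|X_i\|_2^2},$$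 where a summand with $X_i=0$ is read as $0$. Then for all $t>0$ and $\tau>0$, $$\mathbb{P}\left(\left\|\widehat\Sigma_n(\alpha,\tau)-\Sigma\right\|_2\ge t\right)\le 2\,\bar d_\alpha\, e^{-nt/\tau}\left(e^{n\tau^{-\alpha}\sigma^\alpha}+n\tau^{-\alpha}\sigma^\alpha\right)\left(1+\frac{2\tau}{nt}+\frac{2\tau^2}{(nt)^2}\right).$$ -/

import Mathlib

open MeasureTheory ProbabilityTheory

noncomputable section

namespace RobustPCA

/-- The rank-one symmetric matrix `x xᵀ`. -/
def outer {d : ℕ} (x : EuclideanSpace ℝ (Fin d)) : Matrix (Fin d) (Fin d) ℝ :=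
  Matrix.vecMulVec (fun i => x i) (fun i => x i)

/-- The spectral norm `‖A‖₂`: the operator norm of `A` for the Euclidean norm. -/
def spectralNorm {d : ℕ} (A : Matrix (Fin d) (Fin d) ℝ) : ℝ :=
  ‖Matrix.toEuclideanCLM (n := Fin d) (𝕜 := ℝ) A‖

/-- `|A| ^ α` for a symmetric matrix `A`, obtained by applying `x ↦ |x| ^ α` to the eigenvalues of
`A` in a spectral decomposition (the functional calculus of symmetric matrices). -/
def absPow {d : ℕ} (α : ℝ) (A : Matrix (Fin d) (Fin d) ℝ) : Matrix (Fin d) (Fin d) ℝ :=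
  cfc (fun x : ℝ => |x| ^ α) A

/-- The entrywise expectation of a random matrix. -/
def expect {Ω : Type*} [MeasurableSpace Ω] (P : Measure Ω) {d : ℕ}
    (M : Ω → Matrix (Fin d) (Fin d) ℝ) : Matrix (Fin d) (Fin d) ℝ :=
  Matrix.of fun i j => ∫ ω, M ω i j ∂P

/-- `Σ = E[X Xᵀ]`. -/
def covMatrix {Ω : Type*} [MeasurableSpace Ω] (P : Measure Ω) {d : ℕ}
    (X : Ω → EuclideanSpace ℝ (Fin d)) : Matrix (Fin d) (Fin d) ℝ :=
  expect P fun ω => outer (X ω)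

/-- `E |X Xᵀ| ^ α`. -/
def absMoment {Ω : Type*} [MeasurableSpace Ω] (P : Measure Ω) {d : ℕ}
    (X : Ω → EuclideanSpace ℝ (Fin d)) (α : ℝ) : Matrix (Fin d) (Fin d) ℝ :=
  expect P fun ω => absPow α (outer (X ω))

/-- The quantity `σ ^ α = ‖E |X Xᵀ| ^ α‖₂`. -/
def sigmaPow {Ω : Type*} [MeasurableSpace Ω] (P : Measure Ω) {d : ℕ}
    (X : Ω → EuclideanSpace ℝ (Fin d)) (α : ℝ) : ℝ :=
  spectralNorm (absMoment P X α)

/-- The effective dimension `tr (E |X Xᵀ| ^ α) / ‖E |X Xᵀ| ^ α‖₂` (it is `0` when `X = 0` almost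
surely, which is the only case of a vanishing denominator). -/
def effDim {Ω : Type*} [MeasurableSpace Ω] (P : Measure Ω) {d : ℕ}
    (X : Ω → EuclideanSpace ℝ (Fin d)) (α : ℝ) : ℝ :=
  (absMoment P X α).trace / spectralNorm (absMoment P X α)

/-- The truncation function `ψ_τ(x) = (|x| ∧ τ) sign(x)`. -/
def psi (τ x : ℝ) : ℝ := min |x| τ * Real.sign x

/-- The truncated covariance estimator of the sample `x 0, …, x (n - 1)`,
`(1 / n) ∑ i, ψ_τ(‖x i‖₂²) (x i) (x i)ᵀ / ‖x i‖₂²`; the summand of `x i = 0` is `0`. -/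
def truncEstimator {n d : ℕ} (τ : ℝ) (x : Fin n → EuclideanSpace ℝ (Fin d)) :
    Matrix (Fin d) (Fin d) ℝ :=
  (1 / (n : ℝ)) • ∑ i, (psi τ (‖x i‖ ^ 2) / ‖x i‖ ^ 2) • outer (x i)

end RobustPCA

end

noncomputable section

namespace RobustPCA

open Matrix
open scoped Matrix.Norms.L2Operator

/-! ### Diagonalization, traces and the matrix relative entropy -/

section TraceExp

variable {ι : Type*} [Fintype ι] [DecidableEq ι]

/-! The proof is the matrix Laplace transform method. For y = ‖x‖²/τ and ε = ±1, the scalar bound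
exp(ε min(y, 1)) ≤ 1 + εy + y^α (`exp_trunc_le`) lifts to the rank-one matrix x xᵀ, whose
eigenvalues are only 0 and ‖x‖². In expectation, the exponential of one truncated term is at most 1
+ K with K = εΣ/τ + τ^(-α) E|XXᵀ|^α.

Lieb's theorem, in the form `integral_trace_exp_add_le`, replaces the independent terms one at a
time by K inside tr exp. Centring at Σ cancels the first-order part of nK, so that E tr exp(±S) ≤ tr
exp N for the scaled error S = (n/τ)(Σ̂ - Σ) and N = nτ^(-α) E|XXᵀ|^α.

Markov's inequality is applied to tr exp S + tr exp(-S) - 2d, which is at least φ(s) = e^s - 1 - s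
once ‖S‖ ≥ s = nt/τ. The subtracted 2d turns the dimension into the effective dimension, because tr
exp N - d ≤ (tr N/‖N‖)(e^‖N‖ - 1) by convexity. An elementary bound on 1/φ(s) gives the final shape.

Lieb's theorem itself is derived from joint convexity of relative entropy. That convexity follows by
writing the entropy as an integral of quadratic-over-linear terms, each a maximum of functionals
linear in the pair (exp A, exp B). -/

theorem exists_diagonalization_cfc {A : Matrix ι ι ℝ} (hA : A.IsHermitian) :
    ∃ (U : Matrix ι ι ℝ) (a : ι → ℝ), Uᵀ * U = 1 ∧ U * Uᵀ = 1 ∧ A = U * diagonal a * Uᵀ ∧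
      ∀ f : ℝ → ℝ, cfc f A = U * diagonal (fun i => f (a i)) * Uᵀ := by
  refine ⟨hA.eigenvectorUnitary, hA.eigenvalues, ?_, ?_, ?_, fun f => ?_⟩
  · have := Unitary.coe_star_mul_self hA.eigenvectorUnitary
    rwa [star_eq_conjTranspose, conjTranspose_eq_transpose_of_trivial] at this
  · have := Unitary.coe_mul_star_self hA.eigenvectorUnitary
    rwa [Unitary.coe_star, star_eq_conjTranspose, conjTranspose_eq_transpose_of_trivial] at this
  · have := hA.spectral_theorem
    rw [Unitary.conjStarAlgAut_apply, star_eq_conjTranspose,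
      conjTranspose_eq_transpose_of_trivial] at this
    exact this
  · rw [hA.cfc_eq, IsHermitian.cfc, Unitary.conjStarAlgAut_apply, star_eq_conjTranspose,
      conjTranspose_eq_transpose_of_trivial]
    rfl

theorem exists_diagonalization {A : Matrix ι ι ℝ} (hA : A.IsHermitian) :
    ∃ (U : Matrix ι ι ℝ) (a : ι → ℝ), Uᵀ * U = 1 ∧ U * Uᵀ = 1 ∧ A = U * diagonal a * Uᵀ := by
  obtain ⟨U, a, h1, h2, h, -⟩ := exists_diagonalization_cfc hA
  exact ⟨U, a, h1, h2, h⟩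

theorem transpose_mul_conj_diagonal_mul {U : Matrix ι ι ℝ} (h1 : Uᵀ * U = 1) (a : ι → ℝ) :
    Uᵀ * (U * diagonal a * Uᵀ) * U = diagonal a := by
  calc _ = (Uᵀ * U) * diagonal a * (Uᵀ * U) := by simp only [Matrix.mul_assoc]
    _ = _ := by rw [h1, Matrix.one_mul, Matrix.mul_one]

theorem exp_conj_diagonal {U : Matrix ι ι ℝ} (h1 : Uᵀ * U = 1) (h2 : U * Uᵀ = 1) (a : ι → ℝ) :
    NormedSpace.exp (U * diagonal a * Uᵀ) = U * diagonal (fun i => Real.exp (a i)) * Uᵀ := by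
  have hU : U⁻¹ = Uᵀ := inv_eq_right_inv h2
  have hu : IsUnit U := ⟨⟨U, Uᵀ, h2, h1⟩, rfl⟩
  rw [← hU, Matrix.exp_conj U _ hu, Matrix.exp_diagonal]
  congr 3
  ext i
  rw [Pi.coe_exp, Real.exp_eq_exp_ℝ]

theorem trace_mul_conj_diagonal (M U : Matrix ι ι ℝ) (a : ι → ℝ) :
    (M * (U * diagonal a * Uᵀ)).trace = ∑ i, (Uᵀ * M * U) i i * a i := by
  rw [← Matrix.mul_assoc, Matrix.trace_mul_comm, ← Matrix.mul_assoc, ← Matrix.mul_assoc]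
  simp [Matrix.trace, Matrix.mul_diagonal]

theorem trace_conj_diagonal {U : Matrix ι ι ℝ} (h1 : Uᵀ * U = 1) (a : ι → ℝ) :
    (U * diagonal a * Uᵀ).trace = ∑ i, a i := by
  have := trace_mul_conj_diagonal 1 U a
  rw [Matrix.one_mul, Matrix.mul_one, h1] at this
  simpa using this

theorem isHermitian_conj_diagonal (U : Matrix ι ι ℝ) (a : ι → ℝ) :
    (U * diagonal a * Uᵀ).IsHermitian := by
  rw [Matrix.IsHermitian, conjTranspose_eq_transpose_of_trivial]
  simp [Matrix.transpose_mul, Matrix.mul_assoc]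

theorem conj_diagonal_mul {U : Matrix ι ι ℝ} (h1 : Uᵀ * U = 1) (a b : ι → ℝ) :
    (U * diagonal a * Uᵀ) * (U * diagonal b * Uᵀ) = U * diagonal (fun i => a i * b i) * Uᵀ := by
  calc _ = U * diagonal a * (Uᵀ * U) * diagonal b * Uᵀ := by simp only [Matrix.mul_assoc]
    _ = _ := by rw [h1, Matrix.mul_one, Matrix.mul_assoc U, diagonal_mul_diagonal]

/-- The Umegaki relative entropy of `exp A` and `exp B`. -/
def expEntropy (A B : Matrix ι ι ℝ) : ℝ :=
  (NormedSpace.exp A * (A - B)).trace - (NormedSpace.exp A).trace + (NormedSpace.exp B).trace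

theorem sum_sq_row {W : Matrix ι ι ℝ} (h : W * Wᵀ = 1) (i : ι) : ∑ j, W i j ^ 2 = 1 := by
  have := congrFun (congrFun h i) i
  simpa [Matrix.mul_apply, sq] using this

theorem sum_sq_col {W : Matrix ι ι ℝ} (h : Wᵀ * W = 1) (j : ι) : ∑ i, W i j ^ 2 = 1 := by
  have := congrFun (congrFun h j) j
  simpa [Matrix.mul_apply, sq] using this

/-- The squared entries of the orthogonal matrix UᵀV are doubly stochastic, so single sums over
eigenvalues spread out into double sums and the matrix entropy becomes a weighted sum of scalar
entropies. -/
theorem expEntropy_conj_diagonal {U V : Matrix ι ι ℝ} (hU : Uᵀ * U = 1) (hU' : U * Uᵀ = 1)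
    (hV : Vᵀ * V = 1) (hV' : V * Vᵀ = 1) (a b : ι → ℝ) :
    expEntropy (U * diagonal a * Uᵀ) (V * diagonal b * Vᵀ) =
      ∑ i, ∑ j, (Uᵀ * V) i j ^ 2 *
        (Real.exp (a i) * (a i - b j) - Real.exp (a i) + Real.exp (b j)) := by
  have hW : (Uᵀ * V) * (Uᵀ * V)ᵀ = 1 := by
    rw [Matrix.transpose_mul, Matrix.transpose_transpose, Matrix.mul_assoc, ← Matrix.mul_assoc V,
      hV', Matrix.one_mul, hU]
  have hW' : (Uᵀ * V)ᵀ * (Uᵀ * V) = 1 := by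
    rw [Matrix.transpose_mul, Matrix.transpose_transpose, Matrix.mul_assoc, ← Matrix.mul_assoc U,
      hU', Matrix.one_mul, hV]
  have e1 : (U * diagonal (fun i => Real.exp (a i)) * Uᵀ * (V * diagonal b * Vᵀ)).trace
      = ∑ i, ∑ j, (Uᵀ * V) i j ^ 2 * (Real.exp (a i) * b j) := by
    rw [trace_mul_conj_diagonal, Finset.sum_comm]
    refine Finset.sum_congr rfl fun j _ => ?_
    have : Vᵀ * (U * diagonal (fun i => Real.exp (a i)) * Uᵀ) * V
        = (Uᵀ * V)ᵀ * diagonal (fun i => Real.exp (a i)) * (Uᵀ * V) := by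
      simp only [Matrix.transpose_mul, Matrix.transpose_transpose, Matrix.mul_assoc]
    rw [this, Matrix.mul_apply, Finset.sum_mul]
    refine Finset.sum_congr rfl fun i _ => ?_
    rw [Matrix.mul_diagonal, Matrix.transpose_apply]
    ring
  rw [expEntropy, exp_conj_diagonal hU hU', exp_conj_diagonal hV hV', Matrix.mul_sub,
    Matrix.trace_sub, conj_diagonal_mul hU, trace_conj_diagonal hU, trace_conj_diagonal hU,
    trace_conj_diagonal hV, e1]
  have e2 : ∀ f : ι → ℝ, ∑ i, ∑ j, (Uᵀ * V) i j ^ 2 * f i = ∑ i, f i := fun f =>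
    Finset.sum_congr rfl fun i _ => by rw [← Finset.sum_mul, sum_sq_row hW, one_mul]
  have e3 : ∀ f : ι → ℝ, ∑ i, ∑ j, (Uᵀ * V) i j ^ 2 * f j = ∑ j, f j := fun f => by
    rw [Finset.sum_comm]
    exact Finset.sum_congr rfl fun i _ => by rw [← Finset.sum_mul, sum_sq_col hW', one_mul]
  rw [← e2 (fun i => Real.exp (a i) * a i), ← e2 (fun i => Real.exp (a i)),
    ← e3 (fun i => Real.exp (b i))]
  simp only [← Finset.sum_sub_distrib, ← Finset.sum_add_distrib]
  refine Finset.sum_congr rfl fun i _ => Finset.sum_congr rfl fun j _ => ?_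
  ring

/-- Klein's inequality. -/
theorem expEntropy_nonneg {A B : Matrix ι ι ℝ} (hA : A.IsHermitian) (hB : B.IsHermitian) :
    0 ≤ expEntropy A B := by
  obtain ⟨U, a, hU, hU', rfl⟩ := exists_diagonalization hA
  obtain ⟨V, b, hV, hV', rfl⟩ := exists_diagonalization hB
  rw [expEntropy_conj_diagonal hU hU' hV hV']
  refine Finset.sum_nonneg fun i _ => Finset.sum_nonneg fun j _ => mul_nonneg (sq_nonneg _) ?_
  have h1 := Real.add_one_le_exp (b j - a i)
  have h2 : Real.exp (b j) = Real.exp (a i) * Real.exp (b j - a i) := by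
    rw [← Real.exp_add]; ring_nf
  rw [h2]
  nlinarith [Real.exp_pos (a i)]

/-! ### Joint convexity of the relative entropy -/

theorem interpolation_pos {x y u : ℝ} (hx : 0 < x) (hy : 0 < y) (hu : u ∈ Set.Icc (0 : ℝ) 1) :
    0 < (1 - u) * x + u * y := by
  rcases hu.1.eq_or_lt with h | h
  · subst h; simpa
  · nlinarith [mul_pos h hy, mul_nonneg (sub_nonneg.2 hu.2) hx.le]

/-- The integrand is a square over a linear form, hence jointly convex in (x, y) and a maximum of
linear functions; this is what carries over to matrices. -/
theorem integral_interpolation {x y : ℝ} (hx : 0 < x) (hy : 0 < y) :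
    ∫ u in (0 : ℝ)..1, u * ((x - y) ^ 2 / ((1 - u) * x + u * y)) =
      x * (Real.log x - Real.log y) - x + y := by
  have hI : Set.uIcc (0 : ℝ) 1 = Set.Icc 0 1 := Set.uIcc_of_le zero_le_one
  have hder : ∀ u ∈ Set.uIcc (0 : ℝ) 1,
      HasDerivAt (fun u : ℝ => -(x - y) * u - x * Real.log ((1 - u) * x + u * y))
        (u * ((x - y) ^ 2 / ((1 - u) * x + u * y))) u := by
    intro u hu
    have hq := interpolation_pos hx hy (hI ▸ hu)
    have h1 : HasDerivAt (fun u : ℝ => (1 - u) * x + u * y) (-x + y) u := by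
      have := (((hasDerivAt_id u).const_sub 1).mul_const x).add ((hasDerivAt_id u).mul_const y)
      exact this.congr_deriv (by ring)
    have h2 := ((hasDerivAt_id u).const_mul (-(x - y))).sub ((h1.log hq.ne').const_mul x)
    refine h2.congr_deriv ?_
    rw [← mul_div_assoc, ← mul_div_assoc, sub_eq_iff_eq_add, ← add_div, eq_div_iff hq.ne']
    ring
  rw [intervalIntegral.integral_eq_sub_of_hasDerivAt hder]
  · simp
    ring
  · apply ContinuousOn.intervalIntegrable
    rw [hI]
    refine ContinuousOn.mul continuousOn_id (ContinuousOn.div (by fun_prop) (by fun_prop) ?_)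
    exact fun u hu => (interpolation_pos hx hy hu).ne'

omit [DecidableEq ι] in
theorem continuousOn_matrix_mul {C D : ℝ → Matrix ι ι ℝ} {s : Set ℝ} (hC : ContinuousOn C s)
    (hD : ContinuousOn D s) : ContinuousOn (fun u => C u * D u) s :=
  (continuous_fst.matrix_mul continuous_snd).comp_continuousOn (hC.prodMk hD)

omit [DecidableEq ι] in
theorem trace_integral_mul {F : ℝ → Matrix ι ι ℝ} (hF : ContinuousOn F (Set.Icc 0 1))
    (T : Matrix ι ι ℝ) :
    ((Matrix.of fun i j => ∫ u in (0 : ℝ)..1, F u i j) * T).trace =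
      ∫ u in (0 : ℝ)..1, (F u * T).trace := by
  have hint : ∀ i j, IntervalIntegrable (fun u => F u i j) volume 0 1 := fun i j => by
    apply ContinuousOn.intervalIntegrable
    rw [Set.uIcc_of_le zero_le_one]
    exact (continuous_id.matrix_elem i j).comp_continuousOn hF
  simp only [Matrix.trace, Matrix.diag, Matrix.mul_apply, Matrix.of_apply]
  rw [intervalIntegral.integral_finsetSum]
  · refine Finset.sum_congr rfl fun i _ => ?_
    rw [intervalIntegral.integral_finsetSum]
    · refine Finset.sum_congr rfl fun j _ => ?_
      rw [intervalIntegral.integral_mul_const]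
    · exact fun j _ => (hint i j).mul_const _
  · exact fun i _ => by
      simpa only [Finset.sum_fn] using
        IntervalIntegrable.sum Finset.univ fun j _ => (hint i j).mul_const (T j i)

/-- For fixed C the left side is linear in the two matrices. With γ and w the entries of UᵀCV and
UᵀV, it decouples into scalar quadratics 2γ(t - z)w - γ²q with q = (1 - u)t + uz, whose maximum over
γ is w²(t - z)²/q, the integrand of the entropy. -/
theorem trace_test_form {U V : Matrix ι ι ℝ} (hU' : U * Uᵀ = 1) (hV' : V * Vᵀ = 1)
    (t z : ι → ℝ) (C : Matrix ι ι ℝ) (u : ℝ) :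
    ((u • ((2 : ℝ) • Cᵀ - (1 - u) • (C * Cᵀ))) * (U * diagonal t * Uᵀ)).trace +
      ((u • (-((2 : ℝ) • Cᵀ) - u • (Cᵀ * C))) * (V * diagonal z * Vᵀ)).trace =
    ∑ i, ∑ j, u * (2 * (Uᵀ * C * V) i j * ((t i - z j) * (Uᵀ * V) i j) -
      (Uᵀ * C * V) i j ^ 2 * ((1 - u) * t i + u * z j)) := by
  have e1 : (Cᵀ * (U * diagonal t * Uᵀ)).trace
      = ∑ i, ∑ j, (Uᵀ * C * V) i j * (Uᵀ * V) i j * t i := by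
    rw [trace_mul_conj_diagonal]
    refine Finset.sum_congr rfl fun i _ => ?_
    have : Uᵀ * Cᵀ * U = (Uᵀ * V) * (Uᵀ * C * V)ᵀ := by
      simp only [Matrix.transpose_mul, Matrix.transpose_transpose, Matrix.mul_assoc]
      rw [← Matrix.mul_assoc V, hV', Matrix.one_mul]
    rw [this, Matrix.mul_apply, Finset.sum_mul]
    exact Finset.sum_congr rfl fun j _ => by rw [Matrix.transpose_apply]; ring
  have e2 : (Cᵀ * (V * diagonal z * Vᵀ)).trace
      = ∑ i, ∑ j, (Uᵀ * C * V) i j * (Uᵀ * V) i j * z j := by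
    rw [trace_mul_conj_diagonal, Finset.sum_comm]
    refine Finset.sum_congr rfl fun j _ => ?_
    have : Vᵀ * Cᵀ * V = (Uᵀ * C * V)ᵀ * (Uᵀ * V) := by
      simp only [Matrix.transpose_mul, Matrix.transpose_transpose, Matrix.mul_assoc]
      rw [← Matrix.mul_assoc U, hU', Matrix.one_mul]
    rw [this, Matrix.mul_apply, Finset.sum_mul]
    exact Finset.sum_congr rfl fun i _ => by rw [Matrix.transpose_apply]
  have e3 : (C * Cᵀ * (U * diagonal t * Uᵀ)).trace
      = ∑ i, ∑ j, (Uᵀ * C * V) i j ^ 2 * t i := by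
    rw [trace_mul_conj_diagonal]
    refine Finset.sum_congr rfl fun i _ => ?_
    have : Uᵀ * (C * Cᵀ) * U = (Uᵀ * C * V) * (Uᵀ * C * V)ᵀ := by
      simp only [Matrix.transpose_mul, Matrix.transpose_transpose, Matrix.mul_assoc]
      rw [← Matrix.mul_assoc V, hV', Matrix.one_mul]
    rw [this, Matrix.mul_apply, Finset.sum_mul]
    exact Finset.sum_congr rfl fun j _ => by rw [Matrix.transpose_apply]; ring
  have e4 : (Cᵀ * C * (V * diagonal z * Vᵀ)).trace
      = ∑ i, ∑ j, (Uᵀ * C * V) i j ^ 2 * z j := by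
    rw [trace_mul_conj_diagonal, Finset.sum_comm]
    refine Finset.sum_congr rfl fun j _ => ?_
    have : Vᵀ * (Cᵀ * C) * V = (Uᵀ * C * V)ᵀ * (Uᵀ * C * V) := by
      simp only [Matrix.transpose_mul, Matrix.transpose_transpose, Matrix.mul_assoc]
      rw [← Matrix.mul_assoc U, hU', Matrix.one_mul]
    rw [this, Matrix.mul_apply, Finset.sum_mul]
    exact Finset.sum_congr rfl fun i _ => by rw [Matrix.transpose_apply]; ring
  simp only [Matrix.smul_mul, Matrix.sub_mul, Matrix.neg_mul, Matrix.trace_smul, Matrix.trace_sub,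
    Matrix.trace_neg, smul_eq_mul, e1, e2, e3, e4, Finset.mul_sum, ← Finset.sum_sub_distrib,
    ← Finset.sum_neg_distrib, ← Finset.sum_add_distrib]
  refine Finset.sum_congr rfl fun i _ => Finset.sum_congr rfl fun j _ => ?_
  ring

theorem expEntropy_eq_integral {U V : Matrix ι ι ℝ} (hU : Uᵀ * U = 1) (hU' : U * Uᵀ = 1)
    (hV : Vᵀ * V = 1) (hV' : V * Vᵀ = 1) (a b : ι → ℝ) :
    expEntropy (U * diagonal a * Uᵀ) (V * diagonal b * Vᵀ) =
      ∫ u in (0 : ℝ)..1, ∑ i, ∑ j, (Uᵀ * V) i j ^ 2 * (u * ((Real.exp (a i) - Real.exp (b j)) ^ 2 /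
        ((1 - u) * Real.exp (a i) + u * Real.exp (b j)))) := by
  have hint : ∀ i j, IntervalIntegrable (fun u => (Uᵀ * V) i j ^ 2 *
      (u * ((Real.exp (a i) - Real.exp (b j)) ^ 2 /
        ((1 - u) * Real.exp (a i) + u * Real.exp (b j))))) volume 0 1 := fun i j => by
    apply ContinuousOn.intervalIntegrable
    rw [Set.uIcc_of_le zero_le_one]
    refine ContinuousOn.mul (by fun_prop) (ContinuousOn.mul continuousOn_id
      (ContinuousOn.div (by fun_prop) (by fun_prop) ?_))
    exact fun u hu => (interpolation_pos (Real.exp_pos _) (Real.exp_pos _) hu).ne'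
  rw [expEntropy_conj_diagonal hU hU' hV hV', intervalIntegral.integral_finsetSum]
  · refine Finset.sum_congr rfl fun i _ => ?_
    rw [intervalIntegral.integral_finsetSum fun j _ => hint i j]
    refine Finset.sum_congr rfl fun j _ => ?_
    rw [intervalIntegral.integral_const_mul,
      integral_interpolation (Real.exp_pos _) (Real.exp_pos _), Real.log_exp, Real.log_exp]
  · exact fun i _ => by
      simpa only [Finset.sum_fn] using IntervalIntegrable.sum Finset.univ fun j _ => hint i j

omit [DecidableEq ι] in
theorem continuousOn_test_matrices {C : ℝ → Matrix ι ι ℝ} {s : Set ℝ} (hC : ContinuousOn C s) :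
    ContinuousOn (fun u => u • ((2 : ℝ) • (C u)ᵀ - (1 - u) • (C u * (C u)ᵀ))) s ∧
      ContinuousOn (fun u => u • (-((2 : ℝ) • (C u)ᵀ) - u • ((C u)ᵀ * C u))) s := by
  have hCt : ContinuousOn (fun u => (C u)ᵀ) s :=
    (continuous_id.matrix_transpose).comp_continuousOn hC
  have h1 := continuousOn_matrix_mul hC hCt
  have h2 := continuousOn_matrix_mul hCt hC
  constructor <;> fun_prop

/-- The relative entropy has a supporting hyperplane at each pair of positive definite matrices:
this is its joint convexity. -/
theorem exists_expEntropy_support {A₀ B₀ : Matrix ι ι ℝ} (hA₀ : A₀.IsHermitian)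
    (hB₀ : B₀.IsHermitian) :
    ∃ R Q : Matrix ι ι ℝ,
      (∀ A B : Matrix ι ι ℝ, A.IsHermitian → B.IsHermitian →
        (R * NormedSpace.exp A).trace + (Q * NormedSpace.exp B).trace ≤ expEntropy A B) ∧
      (R * NormedSpace.exp A₀).trace + (Q * NormedSpace.exp B₀).trace = expEntropy A₀ B₀ := by
  obtain ⟨U₀, a₀, hU₀, hU₀', rfl⟩ := exists_diagonalization hA₀
  obtain ⟨V₀, b₀, hV₀, hV₀', rfl⟩ := exists_diagonalization hB₀
  -- The maximizer γ = δw/q of 2γδw - γ²q, taken at the eigenvalues of the support point; `C`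
  -- carries it back to the original basis.
  let c : ℝ → Matrix ι ι ℝ := fun u => Matrix.of fun i j =>
    (Real.exp (a₀ i) - Real.exp (b₀ j)) * (U₀ᵀ * V₀) i j /
      ((1 - u) * Real.exp (a₀ i) + u * Real.exp (b₀ j))
  let C : ℝ → Matrix ι ι ℝ := fun u => U₀ * c u * V₀ᵀ
  have hc : ContinuousOn c (Set.Icc 0 1) := by
    refine continuousOn_pi.2 fun i => continuousOn_pi.2 fun j => ?_
    refine ContinuousOn.div (by fun_prop) (by fun_prop) ?_
    exact fun u hu => (interpolation_pos (Real.exp_pos _) (Real.exp_pos _) hu).ne'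
  have hC : ContinuousOn C (Set.Icc 0 1) :=
    continuousOn_matrix_mul (continuousOn_matrix_mul continuousOn_const hc) continuousOn_const
  let F : ℝ → Matrix ι ι ℝ := fun u => u • ((2 : ℝ) • (C u)ᵀ - (1 - u) • (C u * (C u)ᵀ))
  let G : ℝ → Matrix ι ι ℝ := fun u => u • (-((2 : ℝ) • (C u)ᵀ) - u • ((C u)ᵀ * C u))
  obtain ⟨hF, hG⟩ : ContinuousOn F (Set.Icc 0 1) ∧ ContinuousOn G (Set.Icc 0 1) :=
    continuousOn_test_matrices hC
  have htr : ∀ {H : ℝ → Matrix ι ι ℝ}, ContinuousOn H (Set.Icc 0 1) → ∀ T : Matrix ι ι ℝ,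
      IntervalIntegrable (fun u => (H u * T).trace) volume 0 1 := fun {H} hH T => by
    apply ContinuousOn.intervalIntegrable
    rw [Set.uIcc_of_le zero_le_one]
    exact (continuous_id.matrix_trace).comp_continuousOn
      (continuousOn_matrix_mul hH continuousOn_const)
  refine ⟨Matrix.of fun i j => ∫ u in (0 : ℝ)..1, F u i j,
    Matrix.of fun i j => ∫ u in (0 : ℝ)..1, G u i j, ?_, ?_⟩
  · intro A B hA hB
    obtain ⟨U, a, hU, hU', rfl⟩ := exists_diagonalization hA
    obtain ⟨V, b, hV, hV', rfl⟩ := exists_diagonalization hB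
    rw [expEntropy_eq_integral hU hU' hV hV', trace_integral_mul hF, trace_integral_mul hG,
      ← intervalIntegral.integral_add (htr hF _) (htr hG _)]
    refine intervalIntegral.integral_mono_on zero_le_one ((htr hF _).add (htr hG _)) ?_ ?_
    · apply ContinuousOn.intervalIntegrable
      rw [Set.uIcc_of_le zero_le_one]
      refine continuousOn_finsetSum _ fun i _ => continuousOn_finsetSum _ fun j _ => ?_
      refine ContinuousOn.mul (by fun_prop) (ContinuousOn.mul continuousOn_id
        (ContinuousOn.div (by fun_prop) (by fun_prop) ?_))
      exact fun u hu => (interpolation_pos (Real.exp_pos _) (Real.exp_pos _) hu).ne'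
    · intro u hu
      rw [exp_conj_diagonal hU hU', exp_conj_diagonal hV hV', trace_test_form hU' hV']
      refine Finset.sum_le_sum fun i _ => Finset.sum_le_sum fun j _ => ?_
      have hq := interpolation_pos (Real.exp_pos (a i)) (Real.exp_pos (b j)) hu
      set q := (1 - u) * Real.exp (a i) + u * Real.exp (b j)
      set δ := Real.exp (a i) - Real.exp (b j)
      set w := (Uᵀ * V) i j
      set γ := (Uᵀ * C u * V) i j
      rw [mul_left_comm (w ^ 2)]
      refine mul_le_mul_of_nonneg_left ?_ hu.1
      rw [← mul_div_assoc, le_div_iff₀ hq]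
      -- Any γ, optimal or not, gives a lower bound: complete the square.
      nlinarith [sq_nonneg (γ * q - δ * w)]
  · rw [expEntropy_eq_integral hU₀ hU₀' hV₀ hV₀', trace_integral_mul hF, trace_integral_mul hG,
      ← intervalIntegral.integral_add (htr hF _) (htr hG _)]
    refine intervalIntegral.integral_congr fun u hu => ?_
    rw [Set.uIcc_of_le zero_le_one] at hu
    simp only [F, G]
    rw [exp_conj_diagonal hU₀ hU₀', exp_conj_diagonal hV₀ hV₀', trace_test_form hU₀' hV₀']
    refine Finset.sum_congr rfl fun i _ => Finset.sum_congr rfl fun j _ => ?_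
    have hq := interpolation_pos (Real.exp_pos (a₀ i)) (Real.exp_pos (b₀ j)) hu
    -- At the support point γ is the maximizer itself, so equality holds.
    have hcc : U₀ᵀ * C u * V₀ = c u := by
      simp only [C]
      rw [← Matrix.mul_assoc, ← Matrix.mul_assoc, hU₀, Matrix.one_mul, Matrix.mul_assoc, hV₀,
        Matrix.mul_one]
    rw [hcc]
    simp only [c, Matrix.of_apply]
    field_simp
    ring

end TraceExp

/-! ### Positivity and norms through the spectral decomposition -/

section TraceExpOrder

variable {ι : Type*} [Fintype ι] [DecidableEq ι]

theorem trace_exp_mul_nonneg {A N : Matrix ι ι ℝ} (hA : A.IsHermitian) (hN : N.PosSemidef) :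
    0 ≤ (NormedSpace.exp A * N).trace := by
  obtain ⟨U, a, h1, h2, rfl⟩ := exists_diagonalization hA
  rw [exp_conj_diagonal h1 h2, Matrix.trace_mul_comm, trace_mul_conj_diagonal]
  refine Finset.sum_nonneg fun i _ => mul_nonneg ?_ (Real.exp_pos _).le
  have := hN.conjTranspose_mul_mul_same U
  rw [conjTranspose_eq_transpose_of_trivial] at this
  exact this.diag_nonneg

theorem posDef_exp {A : Matrix ι ι ℝ} (hA : A.IsHermitian) : (NormedSpace.exp A).PosDef := by
  obtain ⟨U, a, h1, h2, rfl⟩ := exists_diagonalization hA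
  rw [exp_conj_diagonal h1 h2, ← conjTranspose_eq_transpose_of_trivial]
  refine (PosDef.diagonal fun i => Real.exp_pos (a i)).mul_mul_conjTranspose_same ?_
  intro v w h
  have := congrArg (fun x => x ᵥ* Uᵀ) h
  simpa [Matrix.vecMul_vecMul, h2] using this

theorem exists_exp_eq {T : Matrix ι ι ℝ} (hT : T.PosDef) :
    ∃ A : Matrix ι ι ℝ, A.IsHermitian ∧ NormedSpace.exp A = T := by
  obtain ⟨U, t, h1, h2, rfl⟩ := exists_diagonalization hT.isHermitian
  have ht : ∀ i, 0 < t i := fun i => by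
    have := (hT.conjTranspose_mul_mul_same (B := U) (fun v w h => by
      have := congrArg (fun x => Uᵀ *ᵥ x) h
      simpa [Matrix.mulVec_mulVec, h1] using this)).diag_pos (i := i)
    rw [conjTranspose_eq_transpose_of_trivial] at this
    rw [transpose_mul_conj_diagonal_mul h1] at this
    simpa using this
  refine ⟨U * diagonal (fun i => Real.log (t i)) * Uᵀ, isHermitian_conj_diagonal _ _, ?_⟩
  rw [exp_conj_diagonal h1 h2]
  simp only [Real.exp_log (ht _)]

theorem posSemidef_exp_sub_one_sub {A : Matrix ι ι ℝ} (hA : A.IsHermitian) :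
    (NormedSpace.exp A - 1 - A).PosSemidef := by
  obtain ⟨U, a, h1, h2, rfl⟩ := exists_diagonalization hA
  have e : NormedSpace.exp (U * diagonal a * Uᵀ) - 1 - U * diagonal a * Uᵀ
      = U * diagonal (fun i => Real.exp (a i) - 1 - a i) * Uᴴ := by
    have h3 : (1 : Matrix ι ι ℝ) = U * diagonal (fun _ => (1 : ℝ)) * Uᵀ := by
      rw [diagonal_one, Matrix.mul_one, h2]
    rw [exp_conj_diagonal h1 h2, h3, conjTranspose_eq_transpose_of_trivial, ← Matrix.sub_mul,
      ← Matrix.mul_sub, ← Matrix.sub_mul, ← Matrix.mul_sub, diagonal_sub, diagonal_sub]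
  rw [e]
  refine PosSemidef.mul_mul_conjTranspose_same (PosSemidef.diagonal fun i => ?_) U
  have := Real.add_one_le_exp (a i)
  simp only [Pi.zero_apply]
  linarith

/-- The left norm is the ℓ² operator norm, invariant under orthogonal factors; the right one is the
sup norm of the eigenvalue vector. -/
theorem norm_conj_diagonal {U : Matrix ι ι ℝ} (h1 : Uᵀ * U = 1) (h2 : U * Uᵀ = 1) (a : ι → ℝ) :
    ‖U * diagonal a * Uᵀ‖ = ‖a‖ := by
  have hU : U ∈ unitary (Matrix ι ι ℝ) := by
    rw [Unitary.mem_iff, star_eq_conjTranspose, conjTranspose_eq_transpose_of_trivial]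
    exact ⟨h1, h2⟩
  have hU' : Uᵀ ∈ unitary (Matrix ι ι ℝ) := by
    have := Unitary.star_mem hU
    rwa [star_eq_conjTranspose, conjTranspose_eq_transpose_of_trivial] at this
  rw [CStarRing.norm_mul_mem_unitary _ hU', CStarRing.norm_mem_unitary_mul _ hU,
    l2_opNorm_diagonal]

end TraceExpOrder

/-! ### Lieb's inequality and the matrix Laplace transform -/

section Lieb

variable {d : ℕ} {E : Type*} [MeasurableSpace E] {μ : Measure E}

theorem integrable_comp_of_norm_le [IsFiniteMeasure μ] {f : Matrix (Fin d) (Fin d) ℝ → ℝ}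
    (hf : Continuous f) {G : E → Matrix (Fin d) (Fin d) ℝ} (hG : StronglyMeasurable G) {R : ℝ}
    (hR : ∀ x, ‖G x‖ ≤ R) : Integrable (fun x => f (G x)) μ := by
  have : ProperSpace (Matrix (Fin d) (Fin d) ℝ) := FiniteDimensional.proper ℝ _
  obtain ⟨C, hC⟩ := (isCompact_closedBall (0 : Matrix (Fin d) (Fin d) ℝ) R).exists_bound_of_continuousOn
    hf.continuousOn
  exact Integrable.of_bound (hf.comp_stronglyMeasurable hG).aestronglyMeasurable C
    (.of_forall fun x => hC _ (by simpa using hR x))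

theorem continuous_exp : Continuous (NormedSpace.exp : Matrix (Fin d) (Fin d) ℝ → _) :=
  letI : NormedAlgebra ℚ (Matrix (Fin d) (Fin d) ℝ) := .restrictScalars ℚ ℝ _
  NormedSpace.exp_continuous

theorem trace_mul_expect (M : Matrix (Fin d) (Fin d) ℝ) {T : E → Matrix (Fin d) (Fin d) ℝ}
    (hT : ∀ i j, Integrable (fun x => T x i j) μ) :
    (M * expect μ T).trace = ∫ x, (M * T x).trace ∂μ := by
  simp only [Matrix.trace, Matrix.diag, Matrix.mul_apply, expect, Matrix.of_apply]
  rw [integral_finsetSum]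
  · refine Finset.sum_congr rfl fun i _ => ?_
    rw [integral_finsetSum]
    · exact Finset.sum_congr rfl fun j _ => (integral_const_mul _ _).symm
    · exact fun j _ => (hT j i).const_mul _
  · exact fun i _ => integrable_finsetSum _ fun j _ => (hT j i).const_mul _

theorem trace_expect {T : E → Matrix (Fin d) (Fin d) ℝ}
    (hT : ∀ i j, Integrable (fun x => T x i j) μ) :
    (expect μ T).trace = ∫ x, (T x).trace ∂μ := by
  simpa using trace_mul_expect 1 hT

theorem dotProduct_expect_mulVec (v : Fin d → ℝ) {T : E → Matrix (Fin d) (Fin d) ℝ}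
    (hT : ∀ i j, Integrable (fun x => T x i j) μ) :
    v ⬝ᵥ (expect μ T *ᵥ v) = ∫ x, v ⬝ᵥ (T x *ᵥ v) ∂μ := by
  have e : ∀ N : Matrix (Fin d) (Fin d) ℝ, v ⬝ᵥ (N *ᵥ v) = (vecMulVec v v * N).trace := fun N => by
    rw [Matrix.trace_mul_comm, Matrix.mul_vecMulVec, Matrix.trace_vecMulVec, dotProduct_comm]
  simp only [e, trace_mul_expect _ hT]

theorem isHermitian_expect {T : E → Matrix (Fin d) (Fin d) ℝ} (h : ∀ x, (T x).IsHermitian) :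
    (expect μ T).IsHermitian := by
  ext i j
  simp only [expect, conjTranspose_apply, Matrix.of_apply, star_trivial]
  congr 1
  ext x
  simpa using (h x).apply i j

theorem posSemidef_expect {T : E → Matrix (Fin d) (Fin d) ℝ}
    (hT : ∀ i j, Integrable (fun x => T x i j) μ) (h : ∀ x, (T x).PosSemidef) :
    (expect μ T).PosSemidef := by
  refine PosSemidef.of_dotProduct_mulVec_nonneg
    (isHermitian_expect fun x => (h x).isHermitian) fun v => ?_
  rw [star_trivial, dotProduct_expect_mulVec v hT]
  refine integral_nonneg fun x => ?_
  simpa using (h x).dotProduct_mulVec_nonneg v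

/-- Strict positivity allows a logarithm of the mean of random exponentials. -/
theorem posDef_expect [IsProbabilityMeasure μ] {T : E → Matrix (Fin d) (Fin d) ℝ}
    (hT : ∀ i j, Integrable (fun x => T x i j) μ) (h : ∀ x, (T x).PosDef) :
    (expect μ T).PosDef := by
  refine PosDef.of_dotProduct_mulVec_pos
    (isHermitian_expect fun x => (h x).isHermitian) fun v hv => ?_
  rw [star_trivial, dotProduct_expect_mulVec v hT]
  have hpos : ∀ x, 0 < v ⬝ᵥ (T x *ᵥ v) := fun x => by
    simpa using (h x).dotProduct_mulVec_pos hv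
  have hint : Integrable (fun x => v ⬝ᵥ (T x *ᵥ v)) μ := by
    simp only [dotProduct, mulVec, Finset.mul_sum]
    exact integrable_finsetSum _ fun i _ => integrable_finsetSum _ fun j _ =>
      ((hT i j).mul_const _).const_mul _
  rw [integral_pos_iff_support_of_nonneg (fun x => (hpos x).le) hint]
  have : Function.support (fun x => v ⬝ᵥ (T x *ᵥ v)) = Set.univ :=
    Set.eq_univ_of_forall fun x => (hpos x).ne'
  rw [this]
  simp

/-- The consequence of Lieb's concavity theorem that drives the matrix Laplace transform method. -/
theorem integral_trace_exp_add_le [IsProbabilityMeasure μ] {g : E → Matrix (Fin d) (Fin d) ℝ}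
    (hg : StronglyMeasurable g) {r : ℝ} (hr : ∀ x, ‖g x‖ ≤ r) (hgH : ∀ x, (g x).IsHermitian)
    {H K : Matrix (Fin d) (Fin d) ℝ} (hH : H.IsHermitian) (hK : K.IsHermitian)
    (hgK : (1 + K - expect μ fun x => NormedSpace.exp (g x)).PosSemidef) :
    ∫ x, (NormedSpace.exp (H + g x)).trace ∂μ ≤ (NormedSpace.exp (H + K)).trace := by
  set T : E → Matrix (Fin d) (Fin d) ℝ := fun x => NormedSpace.exp (H + g x) with hT_def
  set Z : E → Matrix (Fin d) (Fin d) ℝ := fun x => NormedSpace.exp (g x) with hZ_def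
  have hTi : ∀ i j, Integrable (fun x => T x i j) μ := fun i j =>
    integrable_comp_of_norm_le (f := fun A => (NormedSpace.exp (H + A) : Matrix (Fin d) (Fin d) ℝ) i j)
      ((continuous_exp.comp (continuous_const.add continuous_id)).matrix_elem i j) hg hr
  have hZi : ∀ i j, Integrable (fun x => Z x i j) μ := fun i j =>
    integrable_comp_of_norm_le (f := fun A => (NormedSpace.exp A : Matrix (Fin d) (Fin d) ℝ) i j)
      (continuous_exp.matrix_elem i j) hg hr
  have htr : ∀ (M : Matrix (Fin d) (Fin d) ℝ) {S : E → Matrix (Fin d) (Fin d) ℝ},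
      (∀ i j, Integrable (fun x => S x i j) μ) → Integrable (fun x => (M * S x).trace) μ :=
    fun M S hS => by
      simp only [Matrix.trace, Matrix.diag, Matrix.mul_apply]
      exact integrable_finsetSum _ fun i _ => integrable_finsetSum _ fun j _ =>
        (hS j i).const_mul _
  have htr1 : ∀ {S : E → Matrix (Fin d) (Fin d) ℝ},
      (∀ i j, Integrable (fun x => S x i j) μ) → Integrable (fun x => (S x).trace) μ :=
    fun hS => by simpa using htr 1 hS
  -- A = log E exp(H + g) and B = log E exp g. Jensen's inequality for the entropy is the supporting
  -- hyperplane at (A, B), integrated.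
  obtain ⟨A, hA, hAT⟩ := exists_exp_eq (posDef_expect hTi fun x => posDef_exp (hH.add (hgH x)))
  obtain ⟨B, hB, hBZ⟩ := exists_exp_eq (posDef_expect hZi fun x => posDef_exp (hgH x))
  have hsub : Integrable (fun x => (H * T x).trace - (T x).trace) μ := (htr H hTi).sub (htr1 hTi)
  obtain ⟨R, Q, hle, heq⟩ := exists_expEntropy_support hA hB
  have hint : ∫ x, ((R * T x).trace + (Q * Z x).trace) ∂μ
      ≤ ∫ x, ((H * T x).trace - (T x).trace + (Z x).trace) ∂μ := by
    refine integral_mono ((htr R hTi).add (htr Q hZi))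
      (hsub.add (htr1 hZi)) fun x => ?_
    -- The two exponents differ by the constant H, so this entropy is linear in the pair (T x, Z x)
    -- and its mean is explicit.
    have := hle (H + g x) (g x) (hH.add (hgH x)) (hgH x)
    rwa [expEntropy, add_sub_cancel_right, Matrix.trace_mul_comm _ H] at this
  rw [integral_add (htr R hTi) (htr Q hZi), integral_add hsub (htr1 hZi),
    integral_sub (htr H hTi) (htr1 hTi), ← trace_mul_expect R hTi, ← trace_mul_expect Q hZi,
    ← trace_mul_expect H hTi, ← trace_expect hTi, ← trace_expect hZi, ← hAT, ← hBZ, heq,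
    expEntropy] at hint
  -- Jensen gives tr(e^A (A - B - H)) ≤ 0, and `h1` and `h2` below add up to tr(e^A (K - B)) ≥ 0
  -- through 1 + B ≤ e^B ≤ 1 + K. Klein's inequality for A against H + K then concludes.
  have hkl := expEntropy_nonneg hA (hH.add hK)
  rw [← trace_expect hTi, ← hAT]
  have h1 := trace_exp_mul_nonneg hA hgK
  have h2 := trace_exp_mul_nonneg hA (posSemidef_exp_sub_one_sub hB)
  rw [← hBZ] at h1
  rw [Matrix.trace_mul_comm H] at hint
  simp only [expEntropy, Matrix.mul_add, Matrix.mul_sub, Matrix.mul_one, Matrix.trace_add,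
    Matrix.trace_sub] at *
  linarith

/-- The matrix Laplace transform of a sum of independent copies. -/
theorem integral_pi_trace_exp_le [IsProbabilityMeasure μ] {g : E → Matrix (Fin d) (Fin d) ℝ}
    (hg : StronglyMeasurable g) {r : ℝ} (hr : ∀ x, ‖g x‖ ≤ r) (hgH : ∀ x, (g x).IsHermitian)
    {K : Matrix (Fin d) (Fin d) ℝ} (hK : K.IsHermitian)
    (hgK : (1 + K - expect μ fun x => NormedSpace.exp (g x)).PosSemidef) (n : ℕ)
    {H : Matrix (Fin d) (Fin d) ℝ} (hH : H.IsHermitian) :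
    ∫ x, (NormedSpace.exp (H + ∑ i, g (x i))).trace ∂(Measure.pi fun _ : Fin n => μ) ≤
      (NormedSpace.exp (H + (n : ℝ) • K)).trace := by
  induction n generalizing H with
  | zero => simp
  | succ n ih =>
    have hmp := (measurePreserving_piFinSuccAbove (fun _ : Fin (n + 1) => μ) 0).symm
    rw [← hmp.integral_comp']
    have hcont : Continuous fun A : Matrix (Fin d) (Fin d) ℝ => (NormedSpace.exp A).trace :=
      continuous_exp.matrix_trace
    have hsum : ∀ p : E × (Fin n → E),
        ∑ i, g ((MeasurableEquiv.piFinSuccAbove (fun _ : Fin (n + 1) => E) 0).symm p i)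
          = g p.1 + ∑ i, g (p.2 i) := fun p => by
      rw [Fin.sum_univ_succ]
      simp [MeasurableEquiv.piFinSuccAbove]
    have hm1 : StronglyMeasurable fun p : E × (Fin n → E) => g p.1 :=
      hg.comp_measurable measurable_fst
    have hm2 : StronglyMeasurable fun p : E × (Fin n → E) => ∑ i, g (p.2 i) :=
      Finset.stronglyMeasurable_fun_sum _ fun i _ =>
        hg.comp_measurable ((measurable_pi_apply i).comp measurable_snd)
    have hn2 : ∀ y : Fin n → E, ‖∑ i, g (y i)‖ ≤ n * r := fun y => by
      refine (norm_sum_le _ _).trans ((Finset.sum_le_sum fun i _ => hr (y i)).trans ?_)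
      simp
    have hint : Integrable (fun p : E × (Fin n → E) =>
        (NormedSpace.exp (H + (g p.1 + ∑ i, g (p.2 i)))).trace)
        (μ.prod (Measure.pi fun _ : Fin n => μ)) := by
      refine integrable_comp_of_norm_le (hcont.comp (continuous_const.add continuous_id))
        (hm1.add hm2) (R := r + n * r) fun p => ?_
      exact (norm_add_le _ _).trans (add_le_add (hr _) (hn2 _))
    simp only [hsum]
    rw [integral_prod _ hint]
    have hstep : ∀ x : E, ∫ y, (NormedSpace.exp (H + (g x + ∑ i, g (y i)))).trace
        ∂(Measure.pi fun _ : Fin n => μ) ≤ (NormedSpace.exp ((H + (n : ℝ) • K) + g x)).trace := by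
      intro x
      -- The first sample point is frozen into the deterministic part, and is integrated out last.
      have := ih (hH.add (hgH x))
      simp only [← add_assoc]
      rwa [add_right_comm H]
    refine (integral_mono hint.integral_prod_left ?_ hstep).trans ?_
    · exact integrable_comp_of_norm_le (hcont.comp (continuous_const.add continuous_id)) hg hr
    · have hnK : ((n : ℝ) • K).IsHermitian := by
        rw [Matrix.IsHermitian, conjTranspose_smul, hK.eq, star_trivial]
      refine (integral_trace_exp_add_le hg hr hgH (hH.add hnK) hK hgK).trans_eq ?_
      rw [Nat.cast_succ, add_smul, one_smul, add_assoc]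

end Lieb

/-! ### Scalar inequalities and spectral estimates -/

section Deterministic

variable {ι : Type*} [Fintype ι] [DecidableEq ι]

theorem conj_diagonal_injective {U : Matrix ι ι ℝ} (h1 : Uᵀ * U = 1) {a b : ι → ℝ}
    (h : U * diagonal a * Uᵀ = U * diagonal b * Uᵀ) : a = b := by
  exact diagonal_injective (by
    rw [← transpose_mul_conj_diagonal_mul h1 a, ← transpose_mul_conj_diagonal_mul h1 b, h])

theorem smul_conj_diagonal (U : Matrix ι ι ℝ) (a : ι → ℝ) (c : ℝ) :
    c • (U * diagonal a * Uᵀ) = U * diagonal (fun i => c * a i) * Uᵀ := by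
  have : diagonal (fun i => c * a i) = c • diagonal a := by
    rw [← diagonal_smul]; rfl
  rw [this, Matrix.mul_smul, Matrix.smul_mul]

theorem eigenvalue_eq_zero_or_eq {U : Matrix ι ι ℝ} (h1 : Uᵀ * U = 1) {a : ι → ℝ} {r : ℝ}
    (h : (U * diagonal a * Uᵀ) * (U * diagonal a * Uᵀ) = r • (U * diagonal a * Uᵀ)) (i : ι) :
    a i = 0 ∨ a i = r := by
  rw [conj_diagonal_mul h1, smul_conj_diagonal] at h
  have := congrFun (conj_diagonal_injective h1 h) i
  rcases eq_or_ne (a i) 0 with h0 | h0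
  · exact Or.inl h0
  · exact Or.inr (mul_right_cancel₀ h0 this)

/-- A tail of the spectral norm is controlled by traces of exponentials. -/
theorem exp_sub_one_sub_le_trace {S : Matrix ι ι ℝ} (hS : S.IsHermitian) {s : ℝ} (hs : 0 < s)
    (h : s ≤ ‖S‖) : Real.exp s - 1 - s ≤
      (NormedSpace.exp S).trace + (NormedSpace.exp (-S)).trace - 2 * Fintype.card ι := by
  obtain ⟨U, a, h1, h2, rfl⟩ := exists_diagonalization hS
  have hneg : -(U * diagonal a * Uᵀ) = U * diagonal (fun i => -a i) * Uᵀ := by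
    have := smul_conj_diagonal U a (-1)
    simpa using this
  rw [norm_conj_diagonal h1 h2] at h
  rw [hneg, exp_conj_diagonal h1 h2, exp_conj_diagonal h1 h2, trace_conj_diagonal h1,
    trace_conj_diagonal h1]
  obtain ⟨i, hi⟩ : ∃ i, s ≤ |a i| := by
    by_contra! hcon
    exact absurd h (not_le.2 ((pi_norm_lt_iff hs).2 hcon))
  have hcard : (2 * Fintype.card ι : ℝ) = ∑ _i : ι, 2 := by simp [mul_comm]
  rw [hcard, ← Finset.sum_add_distrib, ← Finset.sum_sub_distrib]
  have hnn : ∀ b : ℝ, 0 ≤ Real.exp b + Real.exp (-b) - 2 := fun b => by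
    have h1 := Real.add_one_le_exp b
    have h2 := Real.add_one_le_exp (-b)
    linarith
  refine le_trans ?_ (Finset.single_le_sum
    (f := fun i => Real.exp (a i) + Real.exp (-a i) - 2) (fun j _ => hnn (a j)) (Finset.mem_univ i))
  have habs : Real.exp (a i) + Real.exp (-a i) = Real.exp |a i| + Real.exp (-|a i|) := by
    rcases abs_choice (a i) with h | h <;> rw [h]
    rw [neg_neg, add_comm]
  have h3 := Real.add_one_le_exp (-|a i|)
  -- The tangent to exp at s; combined with e^(-|a|) ≥ 1 - |a| and e^s ≥ 1 it yields the value e^s -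
  -- 1 - s.
  have h4 : Real.exp s * (|a i| - s + 1) ≤ Real.exp |a i| := by
    have := mul_le_mul_of_nonneg_left (Real.add_one_le_exp (|a i| - s)) (Real.exp_pos s).le
    rwa [← Real.exp_add, add_sub_cancel] at this
  have h5 : 1 ≤ Real.exp s := Real.one_le_exp hs.le
  simp only [habs]
  nlinarith

/-- The trace of `exp N - 1` in terms of the effective dimension of `N`. -/
theorem trace_exp_sub_card_le {N : Matrix ι ι ℝ} (hN : N.PosSemidef) :
    (NormedSpace.exp N).trace - Fintype.card ι ≤ N.trace / ‖N‖ * (Real.exp ‖N‖ - 1) := by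
  obtain ⟨U, a, h1, h2, rfl⟩ := exists_diagonalization hN.isHermitian
  have ha : ∀ i, 0 ≤ a i := fun i => by
    have := (hN.conjTranspose_mul_mul_same U).diag_nonneg (i := i)
    rw [conjTranspose_eq_transpose_of_trivial] at this
    rw [transpose_mul_conj_diagonal_mul h1] at this
    simpa using this
  rw [exp_conj_diagonal h1 h2, norm_conj_diagonal h1 h2, trace_conj_diagonal h1,
    trace_conj_diagonal h1]
  have hcard : (Fintype.card ι : ℝ) = ∑ _i : ι, 1 := by simp
  rw [hcard, ← Finset.sum_sub_distrib, Finset.sum_div, Finset.sum_mul]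
  refine Finset.sum_le_sum fun i _ => ?_
  have hle : a i ≤ ‖a‖ := (le_abs_self _).trans (norm_le_pi_norm a i)
  rcases (norm_nonneg a).eq_or_lt with h | h
  · rw [← h] at hle
    have : a i = 0 := le_antisymm hle (ha i)
    simp [this]
  · have hconv := convexOn_exp.2 (Set.mem_univ 0) (Set.mem_univ ‖a‖)
      (sub_nonneg.2 ((div_le_one h).2 hle)) (div_nonneg (ha i) h.le) (sub_add_cancel _ _)
    simp only [smul_eq_mul, mul_zero, zero_add, Real.exp_zero, mul_one] at hconv
    rw [div_mul_cancel₀ _ h.ne'] at hconv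
    linarith

/-- For y ≤ 1 the second-order remainder is at most y² ≤ y^α, as α ≤ 2. For y > 1 the exponent is
frozen at ε, and y ≤ y^α absorbs the possibly negative linear term. -/
theorem exp_trunc_le {α y ε : ℝ} (hα : α ∈ Set.Ioc (1 : ℝ) 2) (hy : 0 ≤ y) (hε : ε = 1 ∨ ε = -1) :
    Real.exp (ε * min y 1) ≤ 1 + (ε * y + y ^ α) := by
  rcases le_or_gt y 1 with h | h
  · rw [min_eq_left h]
    have habs : |ε * y| ≤ 1 := by
      rcases hε with rfl | rfl <;> simpa [abs_of_nonneg hy] using h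
    have h1 := (abs_le.1 (Real.abs_exp_sub_one_sub_id_le habs)).2
    have h2 : (ε * y) ^ 2 = y ^ 2 := by rcases hε with rfl | rfl <;> ring
    have h3 : y ^ 2 ≤ y ^ α := by
      rcases hy.eq_or_lt with rfl | hy
      · rw [Real.zero_rpow (by linarith [hα.1])]; simp
      · rw [← Real.rpow_two]
        exact Real.rpow_le_rpow_of_exponent_ge hy h hα.2
    linarith
  · rw [min_eq_right h.le, mul_one]
    have h1 : y ≤ y ^ α := by
      simpa using Real.rpow_le_rpow_of_exponent_le h.le hα.1.le
    rcases hε with rfl | rfl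
    · linarith [Real.exp_one_lt_d9]
    · linarith [Real.exp_le_one_iff.2 (by norm_num : (-1 : ℝ) ≤ 0)]

/-- Clearing denominators, 1 ≤ (e^s - 1 - s) e^(-s) (1 + 2/s + 2/s²) is exactly e^s ≥ 1 + s + s²/2
multiplied by 2(1 + s). Replacing e^m - 1 by e^m + m only weakens the bound. -/
theorem le_of_mul_exp_sub_le {p D m s : ℝ} (hD : 0 ≤ D) (hm : 0 ≤ m) (hs : 0 < s)
    (h : (Real.exp s - 1 - s) * p ≤ 2 * (D * (Real.exp m - 1))) :
    p ≤ 2 * D * Real.exp (-s) * (Real.exp m + m) * (1 + 2 / s + 2 / s ^ 2) := by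
  have hq := Real.quadratic_le_exp_of_nonneg hs.le
  have hφ : 0 < Real.exp s - 1 - s := by nlinarith [sq_pos_of_pos hs]
  have hone : 1 ≤ (Real.exp s - 1 - s) * (Real.exp (-s) * (1 + 2 / s + 2 / s ^ 2)) := by
    have e : (Real.exp s - 1 - s) * (Real.exp (-s) * (1 + 2 / s + 2 / s ^ 2))
        = (Real.exp s - 1 - s) * (s ^ 2 + 2 * s + 2) / (Real.exp s * s ^ 2) := by
      rw [Real.exp_neg]
      field_simp
    rw [e, one_le_div (by positivity)]
    nlinarith
  have hR : 0 ≤ 2 * (D * (Real.exp m + m)) := by positivity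
  rw [mul_comm, ← le_div_iff₀ hφ] at h
  refine h.trans ?_
  rw [div_le_iff₀ hφ]
  calc 2 * (D * (Real.exp m - 1)) ≤ 2 * (D * (Real.exp m + m)) * 1 := by nlinarith
    _ ≤ 2 * (D * (Real.exp m + m)) *
        ((Real.exp s - 1 - s) * (Real.exp (-s) * (1 + 2 / s + 2 / s ^ 2))) :=
      mul_le_mul_of_nonneg_left hone hR
    _ = _ := by ring

end Deterministic

/-! ### Functional calculus of rank-one matrices -/

section Outer

variable {d : ℕ}

theorem isHermitian_outer (x : EuclideanSpace ℝ (Fin d)) : (outer x).IsHermitian := by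
  ext i j
  simp [outer, vecMulVec_apply, mul_comm]

theorem posSemidef_outer (x : EuclideanSpace ℝ (Fin d)) : (outer x).PosSemidef := by
  simpa [outer] using posSemidef_vecMulVec_self_star (fun i => x i)

theorem dotProduct_self_eq (x : EuclideanSpace ℝ (Fin d)) :
    (fun i => x i) ⬝ᵥ (fun i => x i) = ‖x‖ ^ 2 := by
  rw [EuclideanSpace.norm_sq_eq]
  simp [dotProduct, sq]

theorem trace_outer (x : EuclideanSpace ℝ (Fin d)) : (outer x).trace = ‖x‖ ^ 2 := by
  rw [outer, Matrix.trace_vecMulVec, dotProduct_self_eq]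

theorem outer_mul_outer (x : EuclideanSpace ℝ (Fin d)) :
    outer x * outer x = ‖x‖ ^ 2 • outer x := by
  rw [outer, Matrix.vecMulVec_mul_vecMulVec, dotProduct_self_eq, vecMulVec_smul]

theorem norm_outer_le (x : EuclideanSpace ℝ (Fin d)) : ‖outer x‖ ≤ ‖x‖ ^ 2 := by
  obtain ⟨U, a, h1, h2, h⟩ := exists_diagonalization (isHermitian_outer x)
  have hx := outer_mul_outer x
  rw [h] at hx ⊢
  rw [norm_conj_diagonal h1 h2, pi_norm_le_iff_of_nonneg (sq_nonneg _)]
  intro i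
  rcases eigenvalue_eq_zero_or_eq h1 hx i with h0 | h0 <;> rw [h0]
  · simp
  · simp

/-- Since (x xᵀ)² = ‖x‖² x xᵀ, every eigenvalue is 0 or ‖x‖², and the identity need only be checked
at these two values. -/
theorem absPow_outer {α : ℝ} (hα : 1 < α) (x : EuclideanSpace ℝ (Fin d)) :
    absPow α (outer x) = (‖x‖ ^ 2) ^ (α - 1) • outer x := by
  obtain ⟨U, a, h1, h2, h, hf⟩ := exists_diagonalization_cfc (isHermitian_outer x)
  have hx := outer_mul_outer x
  rw [absPow, hf]
  rw [h] at hx ⊢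
  rw [smul_conj_diagonal]
  congr 3
  ext i
  rcases eigenvalue_eq_zero_or_eq h1 hx i with h0 | h0 <;> rw [h0]
  · rw [abs_zero, Real.zero_rpow (by linarith), mul_zero]
  · rw [abs_of_nonneg (sq_nonneg _), ← Real.rpow_add_one' (sq_nonneg _) (by linarith),
      sub_add_cancel]

/-- At the eigenvalue 0 the difference vanishes, so the scalar inequality at ‖x‖² suffices. -/
theorem posSemidef_one_add_sub_exp (x : EuclideanSpace ℝ (Fin d)) {c k : ℝ}
    (h : Real.exp (c * ‖x‖ ^ 2) ≤ 1 + k * ‖x‖ ^ 2) :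
    (1 + k • outer x - NormedSpace.exp (c • outer x)).PosSemidef := by
  obtain ⟨U, a, h1, h2, ho⟩ := exists_diagonalization (isHermitian_outer x)
  have hx := outer_mul_outer x
  rw [ho] at hx ⊢
  have h3 : (1 : Matrix (Fin d) (Fin d) ℝ) = U * diagonal (fun _ => (1 : ℝ)) * Uᵀ := by
    rw [diagonal_one, Matrix.mul_one, h2]
  rw [smul_conj_diagonal, smul_conj_diagonal, exp_conj_diagonal h1 h2, h3, ← Matrix.add_mul,
    ← Matrix.mul_add, ← Matrix.sub_mul, ← Matrix.mul_sub, diagonal_add, diagonal_sub,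
    ← conjTranspose_eq_transpose_of_trivial]
  refine PosSemidef.mul_mul_conjTranspose_same (PosSemidef.diagonal fun i => ?_) U
  rcases eigenvalue_eq_zero_or_eq h1 hx i with h0 | h0 <;> simp only [Pi.zero_apply, h0]
  · simp
  · linarith

theorem continuous_outer : Continuous (outer : EuclideanSpace ℝ (Fin d) → _) :=
  continuous_pi fun i => continuous_pi fun j => by
    simp only [outer, vecMulVec_apply]
    fun_prop

theorem abs_outer_apply_le (x : EuclideanSpace ℝ (Fin d)) (i j : Fin d) :
    |outer x i j| ≤ ‖x‖ ^ 2 := by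
  rw [outer, vecMulVec_apply, abs_mul, sq]
  exact mul_le_mul (PiLp.norm_apply_le x i) (PiLp.norm_apply_le x j) (abs_nonneg _) (norm_nonneg _)

theorem psi_div_sq {τ : ℝ} (x : EuclideanSpace ℝ (Fin d)) :
    psi τ (‖x‖ ^ 2) / ‖x‖ ^ 2 = min (‖x‖ ^ 2) τ / ‖x‖ ^ 2 := by
  rcases (sq_nonneg ‖x‖).eq_or_lt with h | h
  · rw [← h]; simp
  · rw [psi, Real.sign_of_pos h, abs_of_pos h, mul_one]

end Outer

/-! ### Truncated terms, the scaled error and its tail -/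

section Truncation

variable {d : ℕ}

/-- The summand of the truncated estimator, scaled to have norm at most `|ε|`. -/
def truncTerm (ε τ : ℝ) (x : EuclideanSpace ℝ (Fin d)) : Matrix (Fin d) (Fin d) ℝ :=
  (ε * (τ⁻¹ * (psi τ (‖x‖ ^ 2) / ‖x‖ ^ 2))) • outer x

theorem isHermitian_smul {A : Matrix (Fin d) (Fin d) ℝ} (hA : A.IsHermitian) (c : ℝ) :
    (c • A).IsHermitian := by
  rw [Matrix.IsHermitian, conjTranspose_smul, hA.eq, star_trivial]

theorem stronglyMeasurable_truncTerm (ε τ : ℝ) :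
    StronglyMeasurable (truncTerm ε τ : EuclideanSpace ℝ (Fin d) → _) := by
  have h : Measurable fun x : EuclideanSpace ℝ (Fin d) =>
      ε * (τ⁻¹ * (psi τ (‖x‖ ^ 2) / ‖x‖ ^ 2)) := by
    simp only [psi_div_sq]
    fun_prop
  exact h.stronglyMeasurable.smul continuous_outer.stronglyMeasurable

theorem truncWeight_mul {ε τ : ℝ} (hτ : 0 < τ) (x : EuclideanSpace ℝ (Fin d)) :
    (ε * (τ⁻¹ * (psi τ (‖x‖ ^ 2) / ‖x‖ ^ 2))) * ‖x‖ ^ 2 = ε * min (‖x‖ ^ 2 / τ) 1 := by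
  have h1 : min (‖x‖ ^ 2 / τ) 1 = τ⁻¹ * min (‖x‖ ^ 2) τ := by
    rw [← div_self hτ.ne', min_div_div_right hτ.le, div_eq_inv_mul]
  rw [psi_div_sq, h1]
  rcases eq_or_ne (‖x‖ ^ 2) 0 with h | h
  · rw [h, min_eq_left hτ.le]; simp
  · rw [mul_assoc, mul_assoc, div_mul_cancel₀ _ h]

theorem norm_truncTerm_le {ε τ : ℝ} (hτ : 0 < τ) (x : EuclideanSpace ℝ (Fin d)) :
    ‖truncTerm ε τ x‖ ≤ |ε| := by
  rw [truncTerm, norm_smul, Real.norm_eq_abs]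
  refine (mul_le_mul_of_nonneg_left (norm_outer_le x) (abs_nonneg _)).trans ?_
  rw [← abs_of_nonneg (sq_nonneg ‖x‖), ← abs_mul, abs_of_nonneg (sq_nonneg ‖x‖),
    truncWeight_mul hτ, abs_mul]
  refine mul_le_of_le_one_right (abs_nonneg _) ?_
  rw [abs_of_nonneg (le_min (by positivity) zero_le_one)]
  exact min_le_right _ _

theorem posSemidef_truncTerm {α ε τ : ℝ} (hα : α ∈ Set.Ioc (1 : ℝ) 2) (hτ : 0 < τ)
    (hε : ε = 1 ∨ ε = -1) (x : EuclideanSpace ℝ (Fin d)) :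
    (1 + (ε * τ⁻¹ + τ ^ (-α) * (‖x‖ ^ 2) ^ (α - 1)) • outer x -
      NormedSpace.exp (truncTerm ε τ x)).PosSemidef := by
  refine posSemidef_one_add_sub_exp x ?_
  rw [truncWeight_mul hτ]
  have hr := sq_nonneg ‖x‖
  convert exp_trunc_le hα (div_nonneg hr hτ.le) hε using 2
  rw [add_mul, mul_assoc (τ ^ (-α)), ← Real.rpow_add_one' hr (by linarith [hα.1]), sub_add_cancel,
    Real.div_rpow hr hτ.le, Real.rpow_neg hτ.le]
  ring

variable {μ : Measure (EuclideanSpace ℝ (Fin d))}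

/-- The trace of the α-moment is ‖x‖^(2α), and entries of x xᵀ are bounded by ‖x‖² ≤ 1 + ‖x‖^(2α).
-/
theorem integrable_outer [IsFiniteMeasure μ] {α : ℝ} (hα : 1 < α)
    (h : ∀ k l, Integrable (fun x => ((‖x‖ ^ 2) ^ (α - 1) • outer x) k l) μ) (k l : Fin d) :
    Integrable (fun x => outer x k l) μ := by
  have hα' : Integrable (fun x : EuclideanSpace ℝ (Fin d) => (‖x‖ ^ 2) ^ α) μ := by
    have : Integrable (fun x => ((‖x‖ ^ 2) ^ (α - 1) • outer x).trace) μ :=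
      integrable_finsetSum _ fun i _ => h i i
    refine this.congr (.of_forall fun x => ?_)
    simp only
    rw [trace_smul, trace_outer, smul_eq_mul,
      ← Real.rpow_add_one' (sq_nonneg _) (by linarith), sub_add_cancel]
  refine ((integrable_const 1).add hα').mono'
    (continuous_outer.matrix_elem k l).aestronglyMeasurable (.of_forall fun x => ?_)
  refine (abs_outer_apply_le x k l).trans ?_
  simp only [Pi.add_apply]
  have hr := sq_nonneg ‖x‖
  rcases le_or_gt (‖x‖ ^ 2) 1 with h1 | h1
  · linarith [Real.rpow_nonneg hr α]
  · have := Real.rpow_le_rpow_of_exponent_le h1.le hα.le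
    rw [Real.rpow_one] at this
    linarith

/-- The centred estimator, scaled to be a sum of matrices of norm at most one minus its
untruncated mean. -/
def scaledError (μ : Measure (EuclideanSpace ℝ (Fin d))) {n : ℕ} (τ : ℝ)
    (x : Fin n → EuclideanSpace ℝ (Fin d)) : Matrix (Fin d) (Fin d) ℝ :=
  (n / τ) • (truncEstimator τ x - expect μ outer)

theorem smul_scaledError {n : ℕ} (hn : 0 < n) (ε τ : ℝ) (x : Fin n → EuclideanSpace ℝ (Fin d)) :
    ε • scaledError μ τ x = (-(ε * (n / τ))) • expect μ outer + ∑ i, truncTerm ε τ (x i) := by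
  have hn' : (n : ℝ) ≠ 0 := by positivity
  rw [scaledError, truncEstimator, smul_sub, smul_sub, smul_smul, smul_smul, smul_smul, neg_smul,
    sub_eq_neg_add, Finset.smul_sum]
  congr 1
  refine Finset.sum_congr rfl fun i _ => ?_
  rw [truncTerm, smul_smul]
  congr 1
  field_simp

theorem integral_trace_exp_scaledError_le [IsProbabilityMeasure μ] {α ε τ : ℝ}
    (hα : α ∈ Set.Ioc (1 : ℝ) 2) (hτ : 0 < τ) (hε : ε = 1 ∨ ε = -1)
    (h : ∀ k l, Integrable (fun x => ((‖x‖ ^ 2) ^ (α - 1) • outer x) k l) μ) {n : ℕ} (hn : 0 < n) :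
    ∫ x, (NormedSpace.exp (ε • scaledError μ τ x)).trace ∂(Measure.pi fun _ : Fin n => μ) ≤
      (NormedSpace.exp ((n * τ ^ (-α)) •
        expect μ fun x => (‖x‖ ^ 2) ^ (α - 1) • outer x)).trace := by
  set M := expect μ fun x => (‖x‖ ^ 2) ^ (α - 1) • outer x with hM
  have ho := integrable_outer hα.1 h
  have hSH : (expect μ (outer (d := d))).IsHermitian := isHermitian_expect isHermitian_outer
  have hMH : M.IsHermitian :=
    isHermitian_expect fun x => isHermitian_smul (isHermitian_outer x) _
  have hK := (isHermitian_smul hSH (ε * τ⁻¹)).add (isHermitian_smul hMH (τ ^ (-α)))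
  have hg := stronglyMeasurable_truncTerm (d := d) ε τ
  have hexp : ∀ i j, Integrable (fun x => NormedSpace.exp (truncTerm ε τ x) i j) μ := fun i j =>
    integrable_comp_of_norm_le (f := fun A => (NormedSpace.exp A : Matrix (Fin d) (Fin d) ℝ) i j)
      (continuous_exp.matrix_elem i j) hg (norm_truncTerm_le hτ)
  have hk : ∀ i j, Integrable (fun x : EuclideanSpace ℝ (Fin d) =>
      ((ε * τ⁻¹ + τ ^ (-α) * (‖x‖ ^ 2) ^ (α - 1)) • outer x) i j) μ := fun i j => by
    refine (((ho i j).const_mul (ε * τ⁻¹)).add ((h i j).const_mul (τ ^ (-α)))).congr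
      (.of_forall fun x => ?_)
    simp only [Pi.add_apply, Matrix.smul_apply, smul_eq_mul]
    ring
  have hpsd : (1 + ((ε * τ⁻¹) • expect μ outer + τ ^ (-α) • M) -
      expect μ fun x => NormedSpace.exp (truncTerm ε τ x)).PosSemidef := by
    have key := posSemidef_expect (μ := μ)
      (T := fun x => 1 + (ε * τ⁻¹ + τ ^ (-α) * (‖x‖ ^ 2) ^ (α - 1)) • outer x -
        NormedSpace.exp (truncTerm ε τ x))
      (fun i j => ((integrable_const _).add (hk i j)).sub (hexp i j))
      (posSemidef_truncTerm hα hτ hε)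
    convert key using 1
    ext i j
    simp only [expect, Matrix.of_apply, Matrix.add_apply, Matrix.sub_apply, Matrix.smul_apply,
      smul_eq_mul, hM]
    have hk' : Integrable (fun x : EuclideanSpace ℝ (Fin d) =>
      (ε * τ⁻¹ + τ ^ (-α) * (‖x‖ ^ 2) ^ (α - 1)) * outer x i j) μ := hk i j
    have h' : Integrable (fun x : EuclideanSpace ℝ (Fin d) =>
      (‖x‖ ^ 2) ^ (α - 1) * outer x i j) μ := h i j
    rw [integral_sub (by exact (integrable_const _).add hk') (hexp i j),
      integral_add (integrable_const _) hk', ← integral_const_mul, ← integral_const_mul,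
      ← integral_add ((ho i j).const_mul _) (h'.const_mul _)]
    simp only [integral_const, probReal_univ, one_smul]
    congr 3
    ext x
    ring
  -- The deterministic part -ε(n/τ)Σ cancels the first-order part of nK, leaving only the α-moment.
  have := integral_pi_trace_exp_le hg (norm_truncTerm_le hτ)
    (fun x => isHermitian_smul (isHermitian_outer x) _) hK hpsd n
    (isHermitian_smul hSH (-(ε * (n / τ))))
  simp only [smul_scaledError hn]
  refine this.trans_eq ?_
  congr 2
  rw [smul_add, smul_smul, smul_smul, ← add_assoc, ← add_smul]
  have : -(ε * (n / τ)) + n * (ε * τ⁻¹) = 0 := by ring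
  rw [this, zero_smul, zero_add]

theorem integrable_trace_exp_scaledError [IsProbabilityMeasure μ] {ε τ : ℝ} (hτ : 0 < τ) {n : ℕ}
    (hn : 0 < n) : Integrable (fun x => (NormedSpace.exp (ε • scaledError μ τ x)).trace)
      (Measure.pi fun _ : Fin n => μ) := by
  simp only [smul_scaledError hn]
  refine integrable_comp_of_norm_le (f := fun A : Matrix (Fin d) (Fin d) ℝ =>
      (NormedSpace.exp ((-(ε * (n / τ))) • expect μ outer + A)).trace)
    (continuous_exp.comp (continuous_const.add continuous_id)).matrix_trace
    (Finset.stronglyMeasurable_fun_sum _ fun i _ =>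
      (stronglyMeasurable_truncTerm ε τ).comp_measurable (measurable_pi_apply i))
    (R := ∑ _i : Fin n, |ε|) fun y => ?_
  exact (norm_sum_le _ _).trans (Finset.sum_le_sum fun i _ => norm_truncTerm_le hτ (y i))

theorem isHermitian_scaledError {n : ℕ} (hn : 0 < n) (τ : ℝ)
    (x : Fin n → EuclideanSpace ℝ (Fin d)) : (scaledError μ τ x).IsHermitian := by
  have h := smul_scaledError (μ := μ) hn 1 τ x
  rw [one_smul] at h
  rw [h]
  refine (isHermitian_smul (isHermitian_expect isHermitian_outer) _).add ?_
  rw [Matrix.IsHermitian, conjTranspose_sum]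
  exact Finset.sum_congr rfl fun i _ => isHermitian_smul (isHermitian_outer _) _

theorem pi_tail_bound [IsProbabilityMeasure μ] {α τ : ℝ} (hα : α ∈ Set.Ioc (1 : ℝ) 2) (hτ : 0 < τ)
    (h : ∀ k l, Integrable (fun x => ((‖x‖ ^ 2) ^ (α - 1) • outer x) k l) μ) {n : ℕ} (hn : 0 < n)
    {s : ℝ} (hs : 0 < s) {N : Matrix (Fin d) (Fin d) ℝ}
    (hN : N = (n * τ ^ (-α)) • expect μ fun x => (‖x‖ ^ 2) ^ (α - 1) • outer x) :
    (Measure.pi fun _ : Fin n => μ).real {x | s ≤ ‖scaledError μ τ x‖} ≤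
      2 * (N.trace / ‖N‖) * Real.exp (-s) * (Real.exp ‖N‖ + ‖N‖) * (1 + 2 / s + 2 / s ^ 2) := by
  have hNp : N.PosSemidef := by
    rw [hN]
    exact (posSemidef_expect h fun x => (posSemidef_outer x).smul (by positivity)).smul
      (by positivity)
  have hp := integral_trace_exp_scaledError_le hα hτ (Or.inl rfl) h hn
  have hm := integral_trace_exp_scaledError_le hα hτ (Or.inr rfl) h hn
  rw [← hN] at hp hm
  have hip := integrable_trace_exp_scaledError (μ := μ) (ε := 1) hτ hn
  have him := integrable_trace_exp_scaledError (μ := μ) (ε := -1) hτ hn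
  have htr := trace_exp_sub_card_le hNp
  simp only [one_smul, neg_smul] at hp hm hip him
  refine le_of_mul_exp_sub_le (div_nonneg hNp.trace_nonneg (norm_nonneg _)) (norm_nonneg _) hs ?_
  -- Subtracting 2d keeps this nonnegative, as Markov's inequality requires, and leaves a mean of at
  -- most 2(tr exp N - d).
  let F : (Fin n → EuclideanSpace ℝ (Fin d)) → ℝ := fun x =>
    (NormedSpace.exp (scaledError μ τ x)).trace + (NormedSpace.exp (-scaledError μ τ x)).trace -
      2 * Fintype.card (Fin d)
  have hFi : Integrable F (Measure.pi fun _ : Fin n => μ) :=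
    (hip.add him).sub (integrable_const _)
  have hF0 : ∀ x, 0 ≤ F x := fun x => by
    have hH := isHermitian_scaledError (μ := μ) hn τ x
    have h1 := (posSemidef_exp_sub_one_sub hH).trace_nonneg
    have h2 := (posSemidef_exp_sub_one_sub hH.neg).trace_nonneg
    simp only [trace_sub, trace_neg, trace_one] at h1 h2
    simp only [F]
    linarith
  have hmk := mul_meas_ge_le_integral_of_nonneg (.of_forall hF0) hFi (Real.exp s - 1 - s)
  have hsub : {x | s ≤ ‖scaledError μ τ x‖} ⊆ {x | Real.exp s - 1 - s ≤ F x} := fun x hx =>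
    exp_sub_one_sub_le_trace (isHermitian_scaledError hn τ x) hs hx
  have hφ : 0 ≤ Real.exp s - 1 - s := by linarith [Real.add_one_le_exp s]
  refine (mul_le_mul_of_nonneg_left (measureReal_mono hsub) hφ).trans (hmk.trans ?_)
  have hsum : Integrable (fun x => (NormedSpace.exp (scaledError μ τ x)).trace +
    (NormedSpace.exp (-scaledError μ τ x)).trace) (Measure.pi fun _ : Fin n => μ) := hip.add him
  simp only [F]
  rw [integral_sub hsum (integrable_const _), integral_add hip him, integral_const]
  simp only [probReal_univ, one_smul]
  linarith

theorem expect_map {Ω : Type*} [MeasurableSpace Ω] {P : Measure Ω}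
    {X : Ω → EuclideanSpace ℝ (Fin d)} (hX : AEMeasurable X P)
    {T : EuclideanSpace ℝ (Fin d) → Matrix (Fin d) (Fin d) ℝ}
    (hT : ∀ i j, Measurable fun x => T x i j) :
    expect (P.map X) T = expect P fun ω => T (X ω) := by
  ext i j
  simp only [expect, Matrix.of_apply]
  exact integral_map hX (hT i j).aestronglyMeasurable

theorem measurable_pow_smul_outer (β : ℝ) (i j : Fin d) :
    Measurable fun x : EuclideanSpace ℝ (Fin d) => ((‖x‖ ^ 2) ^ β • outer x) i j := by
  simp only [Matrix.smul_apply, smul_eq_mul]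
  exact Measurable.mul (by fun_prop) (continuous_outer.matrix_elem i j).measurable

theorem measurableSet_tail {n : ℕ} (hn : 0 < n) (τ s : ℝ) :
    MeasurableSet {x : Fin n → EuclideanSpace ℝ (Fin d) | s ≤ ‖scaledError μ τ x‖} := by
  have e : ∀ x : Fin n → EuclideanSpace ℝ (Fin d), scaledError μ τ x =
      (-(1 * (n / τ))) • expect μ outer + ∑ i, truncTerm 1 τ (x i) := fun x => by
    rw [← smul_scaledError hn, one_smul]
  simp only [e]
  have hm : StronglyMeasurable fun x : Fin n → EuclideanSpace ℝ (Fin d) =>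
      (-(1 * (n / τ))) • expect μ outer + ∑ i, truncTerm 1 τ (x i) :=
    stronglyMeasurable_const.add (Finset.stronglyMeasurable_fun_sum _ fun i _ =>
      (stronglyMeasurable_truncTerm 1 τ).comp_measurable (measurable_pi_apply i))
  exact measurableSet_le measurable_const hm.norm.measurable

end Truncation

end RobustPCA

end

/-! ### Transfer from the law of X to the random sample -/

theorem mainTheorem5 {Ω : Type*} [MeasurableSpace Ω] (P : Measure Ω) [IsProbabilityMeasure P]
    (n d : ℕ) (hn : 0 < n) (α : ℝ) (hα : α ∈ Set.Ioc (1 : ℝ) 2)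
    (X : Ω → EuclideanSpace ℝ (Fin d)) (Xs : Fin n → Ω → EuclideanSpace ℝ (Fin d))
    (hident : ∀ i, IdentDistrib (Xs i) X P P) (hindep : iIndepFun Xs P)
    (hmean : ∀ k, ∫ ω, X ω k ∂P = 0)
    (hmoment : ∀ k l, Integrable (fun ω => RobustPCA.absPow α (RobustPCA.outer (X ω)) k l) P)
    (t τ : ℝ) (ht : 0 < t) (hτ : 0 < τ) :
    P.real {ω | t ≤ RobustPCA.spectralNorm
        (RobustPCA.truncEstimator τ (fun i => Xs i ω) - RobustPCA.covMatrix P X)} ≤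
      2 * RobustPCA.effDim P X α * Real.exp (-(n * t / τ)) *
        (Real.exp (n * τ ^ (-α) * RobustPCA.sigmaPow P X α) +
          n * τ ^ (-α) * RobustPCA.sigmaPow P X α) *
        (1 + 2 * τ / (n * t) + 2 * τ ^ 2 / (n * t) ^ 2) := by
  open RobustPCA in
  open scoped Matrix.Norms.L2Operator in
  have hnR : (0 : ℝ) < n := by exact_mod_cast hn
  have hX : AEMeasurable X P := (hident ⟨0, hn⟩).aemeasurable_snd
  have hXs : ∀ i, AEMeasurable (Xs i) P := fun i => (hident i).aemeasurable_fst
  set μ := P.map X with hμ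
  have : IsProbabilityMeasure μ := Measure.isProbabilityMeasure_map hX
  have hpi : P.map (fun ω i => Xs i ω) = Measure.pi fun _ : Fin n => μ := by
    rw [(iIndepFun_iff_map_fun_eq_pi_map hXs).1 hindep]
    congr 1
    ext1 i
    exact (hident i).map_eq
  have hmom : ∀ k l, Integrable (fun x => ((‖x‖ ^ 2) ^ (α - 1) • outer x) k l) μ := fun k l => by
    rw [hμ, integrable_map_measure (measurable_pow_smul_outer _ k l).aestronglyMeasurable hX]
    refine (hmoment k l).congr (.of_forall fun ω => ?_)
    simp only [absPow_outer hα.1, Function.comp_apply]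
  have hcov : expect μ outer = covMatrix P X :=
    expect_map hX fun i j => (continuous_outer.matrix_elem i j).measurable
  have hM : (expect μ fun x => (‖x‖ ^ 2) ^ (α - 1) • outer x) = absMoment P X α := by
    rw [hμ, expect_map hX (measurable_pow_smul_outer _), absMoment]
    simp only [absPow_outer hα.1]
  have hs : 0 < n * t / τ := by positivity
  have hc : 0 < n * τ ^ (-α) := by positivity
  -- Scaling by n/τ turns the threshold t into s = nt/τ.
  have hset : {ω | t ≤ RobustPCA.spectralNorm (truncEstimator τ (fun i => Xs i ω) - covMatrix P X)} =
      (fun ω i => Xs i ω) ⁻¹' {x | n * t / τ ≤ ‖scaledError μ τ x‖} := by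
    ext ω
    simp only [Set.mem_ofPred_eq, Set.mem_preimage, scaledError, hcov, norm_smul, RobustPCA.spectralNorm]
    rw [Real.norm_of_nonneg (by positivity), mul_div_right_comm,
      mul_le_mul_iff_right₀ (by positivity), Matrix.cstar_norm_def]
  have key := pi_tail_bound hα hτ hmom hn hs rfl
  -- The factor nτ^(-α) cancels in tr N/‖N‖, which is therefore the effective dimension.
  rw [hM, ← hpi, map_measureReal_apply_of_aemeasurable (aemeasurable_pi_lambda _ hXs)
    (measurableSet_tail hn τ _), ← hset, Matrix.trace_smul, norm_smul, smul_eq_mul,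
    Real.norm_of_nonneg hc.le, mul_div_mul_left _ _ hc.ne'] at key
  have e1 : 2 * τ / (n * t) = 2 / (n * t / τ) := by field_simp
  have e2 : 2 * τ ^ 2 / (n * t) ^ 2 = 2 / (n * t / τ) ^ 2 := by field_simp
  rw [e1, e2, effDim, sigmaPow, RobustPCA.spectralNorm, ← Matrix.cstar_norm_def]
  exact key
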